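/- **Plant and constraints.** Let $x_{t+1}=Ax_t+Bu_t$, $t=0,1,2,\dots$, with $x_t\in\mathbb R^{n_x}$, $u_t\in\mathbb R^m$, and let $\mathcal X=\{x: P_xx\le p_x\}$, $\mathcal U=\{u: P_uu\le p_u\}$ be polyhedra. Fix margin vectors $\varepsilon_x,\varepsilon_u$ with strictly positive entries and put $\mathcal X^\varepsilon=\{x:P_xx\le p_x-\varepsilon_x\}$, $\mathcal U^\varepsilon=\{u:P_uu\le p_u-\varepsilon_u\}$. Write $\|v\|_M^2=v^{T}Mv$. Let $Q,R,T$ be symmetric positive definite, let $K$ be such that all eigenvalues of $A+BK$ lie in the open unit disc, and let $P=(A+BK)^TP(A+BK)+Q+K^TRK$. **Tracking problem.** Let $\tilde{\mathcal O}_\infty$ be the set of all $(x,\bar x,\bar u)$ with $\bar x\in\mathcal X^\varepsilon$, $\bar u\in\mathcal U^\varepsilon$ such that the trajectory $z_0=x$, $z_{k+1}=Az_k+B(\bar u+K(z_k-\bar x))$ satisfies $z_k\in\mathcal X$ and $\bar u+K(z_k-\bar x)\in\mathcal U$ for all $k\ge0$. For the uniform horizon $H=[N]$ and the constant reference $r\in\mathbb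 R^{n_x}$, the problem $\mathcal P(x,r)$ is to minimize $$\sum_{k=0}^{N-1}\bigl(\|x_k-\bar x\|_Q^2+\|u_k-\bar u\|_R^2\bigr)+\|x_N-\bar x\|_P^2+\|\bar x-r\|_T^2$$ over $(x_k)_{k\le N},(u_k)_{k<N},\bar x,\bar u$ subject to $x_0=x$, $x_{k+1}=Ax_k+Bu_k$ and $u_k\in\mathcal U$ for $k<N$, $x_k\in\mathcal X$ for $k\le N$, $(x_N,\bar x,\bar u)\in\tilde{\mathcal O}_\infty$, and $(A-I)\bar x+B\bar u=0$. **Network.** Let $\gamma_t,\theta_t$ be $\{0,1\}$-valued random variables on a probability space ($\gamma_t=1$: the plant packet of time $t$ is available to the controller for computing the packet $U_{t+1}$; $\theta_t=1$: the controller packet $U_t$ is available to the actuator at time $t$). Let $n\ge1$ be the communication-rate parameter: the plant packet of time $t$ is sent only if $n\mid t+1$, and $U_t$ is sent only if $n\mid t$, so $\gamma_t=1\Rightarrow n\mid t+1$ and $\theta_t=1\Rightarrow n\mid t$. **Closed loop.** A packet $U_t$ consists of inputs $u_{(t,0)},\dots,u_{(t,N-1)}$, a pair $(\bar x_t,\bar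 u_t)$ and a time stamp $q_t$. The input it prescribes $k$ steps after time $t$ in state $z$ is $\kappa_t(k,z)=u_{(t,k)}$ if $k<N$, and $\kappa_t(k,z)=\bar u_t+K(z-\bar x_t)$ if $k\ge N$. * *Controller and estimator.* At each time $t\ge0$, with $\hat t=t-(t \bmod n)$, set $\hat x_{t|t}=\gamma_tx_t+(1-\gamma_t)\hat x_{t|t-1}$, $\hat u_{t|t}=\gamma_tu_t+(1-\gamma_t)\,\kappa_{\hat t}(t \bmod n,\hat x_{t|t})$, $\hat x_{t+1|t}=A\hat x_{t|t}+B\hat u_{t|t}$ and $q_{t+1}=\gamma_tt+(1-\gamma_t)q_t$. If $n\mid t+1$ and $\mathcal P(\hat x_{t+1|t},r)$ is feasible, then the trajectory and steady state of $U_{t+1}$ are those of an optimal solution of it (if it is infeasible, they are arbitrary). * *Smart actuator.* For $t\ge1$, $U_t$ is consistent if $\theta_t=1$ and $\theta_{q_t+1+kn}=1$ for all $0\le k\le\lfloor(t-q_t-1)/n\rfloor$. Put $s_t=t$ if $U_t$ is consistent and $s_t=s_{t-1}$ otherwise. At every $t\ge0$ the input is $u_t=\kappa_{s_t}(t-s_t,x_t)$.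 The initial values of the state, the estimate, the time stamps and the buffered packet are arbitrary. **Theorem.** Assume that, almost surely, for every $t$ there is $\bar t\ge t$ with $\gamma_{\bar t}=1$ and $\theta_{\bar t+1}=1$. Assume that the initial problem is feasible: almost surely there is a time $t_0\ge1$ with $\gamma_{t_0-1}=1$, $\theta_{t_0}=1$ such that $\mathcal P(x_{t_0},r)$ is feasible. Assume that $r$ has an admissible steady state: there is $u_r$ with $(A-I)r+Bu_r=0$, $r\in\mathcal X^\varepsilon$, $u_r\in\mathcal U^\varepsilon$. Then $\lim_{t\to\infty}x_t=r$ almost surely. -/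

import Mathlib

open Matrix Filter Topology MeasureTheory

noncomputable section

namespace NetMPC

/-- The quadratic form `vᵀ M v`. -/
def qform {d : ℕ} (M : Matrix (Fin d) (Fin d) ℝ) (v : Fin d → ℝ) : ℝ := v ⬝ᵥ (M *ᵥ v)

/-- A real square matrix is Schur stable: all its complex eigenvalues lie in the open unit disc. -/
def IsSchur {d : ℕ} (M : Matrix (Fin d) (Fin d) ℝ) : Prop :=
  ∀ z ∈ spectrum ℂ (M.map (algebraMap ℝ ℂ)), ‖z‖ < 1

/-- The numerical data of the plant and of the controller (no properties are imposed here):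
system matrices, auxiliary gain, constraint polyhedra `Px x ≤ px`, `Pu u ≤ pu`, cost matrices, and
the margins `ex`, `eu` by which the constraints on the artificial steady states are tightened in the
finitely determined approximation of the maximal output admissible set. -/
structure Data (nx m cx cu : ℕ) where
  A : Matrix (Fin nx) (Fin nx) ℝ
  B : Matrix (Fin nx) (Fin m) ℝ
  K : Matrix (Fin m) (Fin nx) ℝ
  Px : Matrix (Fin cx) (Fin nx) ℝ
  px : Fin cx → ℝ
  Pu : Matrix (Fin cu) (Fin m) ℝ
  pu : Fin cu → ℝ
  Q : Matrix (Fin nx) (Fin nx) ℝ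
  R : Matrix (Fin m) (Fin m) ℝ
  P : Matrix (Fin nx) (Fin nx) ℝ
  T : Matrix (Fin nx) (Fin nx) ℝ
  ex : Fin cx → ℝ
  eu : Fin cu → ℝ

/-- Index of the sub-interval containing step `k`, where the sub-intervals have lengths given by
the list and are numbered from `i` on. -/
def stepMultFrom : ℕ → List ℕ → ℕ → ℕ
  | i, [], _ => i
  | i, h :: H, k => if k < h then i else stepMultFrom (i + 1) H (k - h)

/-- For a horizon `H = [h₁, h₂, …]`: the multiple of the base sample time used at step `k`
(`1` for the first `h₁` steps, `2` for the next `h₂` steps, and so on). -/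
def stepMult (H : List ℕ) (k : ℕ) : ℕ := stepMultFrom 1 H k

/-- The length `h₁` of the first sub-interval. -/
def firstLen (H : List ℕ) : ℕ := H.headD 0

/-- An input and state trajectory together with an artificial steady state. Only the inputs with
index `< H.sum` and the states with index `≤ H.sum` are meaningful. -/
structure Plan (nx m : ℕ) where
  state : ℕ → Fin nx → ℝ
  input : ℕ → Fin m → ℝ
  xbar : Fin nx → ℝ
  ubar : Fin m → ℝ

namespace Data

variable {nx m cx cu : ℕ} (D : Data nx m cx cu)

/-- The state constraint set. -/
def stateSet : Set (Fin nx → ℝ) := {x | D.Px *ᵥ x ≤ D.px}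

/-- The input constraint set. -/
def inputSet : Set (Fin m → ℝ) := {u | D.Pu *ᵥ u ≤ D.pu}

/-- The same data with the constraints tightened by the margins. -/
def tight : Data nx m cx cu := { D with px := D.px - D.ex, pu := D.pu - D.eu }

/-- The state transition matrix `A ^ i` over `i` base steps. -/
def stepA (i : ℕ) : Matrix (Fin nx) (Fin nx) ℝ := D.A ^ i

/-- The input matrix over `i` base steps with constant input. -/
def stepB (i : ℕ) : Matrix (Fin nx) (Fin m) ℝ := ∑ j ∈ Finset.range i, D.A ^ j * D.B

/-- `(xbar, ubar)` is a steady state. -/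
def IsSteady (xbar : Fin nx → ℝ) (ubar : Fin m → ℝ) : Prop :=
  (D.A - 1) *ᵥ xbar + D.B *ᵥ ubar = 0

/-- The auxiliary feedback law. -/
def auxLaw (x xbar : Fin nx → ℝ) (ubar : Fin m → ℝ) : Fin m → ℝ := ubar + D.K *ᵥ (x - xbar)

/-- One step of the autonomous extended system `w = (x, xbar, ubar)` under the auxiliary law. -/
def auxStep (w : (Fin nx → ℝ) × (Fin nx → ℝ) × (Fin m → ℝ)) :
    (Fin nx → ℝ) × (Fin nx → ℝ) × (Fin m → ℝ) :=
  ((D.A + D.B * D.K) *ᵥ w.1 - (D.B * D.K) *ᵥ w.2.1 + D.B *ᵥ w.2.2, w.2.1, w.2.2)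

/-- States in the constraint set from which the steps of the sub-intervals after the first can be
carried out admissibly. For `H = [N]` there are no such steps. -/
def feasSecond (H : List ℕ) : Set (Fin nx → ℝ) :=
  {x | x ∈ D.stateSet ∧ ∃ (z : ℕ → Fin nx → ℝ) (v : ℕ → Fin m → ℝ), z (firstLen H) = x ∧
    ∀ k, firstLen H ≤ k → k < H.sum →
      v k ∈ D.inputSet ∧
      z (k + 1) = D.stepA (stepMult H k) *ᵥ z k + D.stepB (stepMult H k) *ᵥ v k ∧
      z (k + 1) ∈ D.stateSet}

/-- The constraint set of the extended autonomous system. -/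
def auxConstr (H : List ℕ) : Set ((Fin nx → ℝ) × (Fin nx → ℝ) × (Fin m → ℝ)) :=
  {w | w.1 ∈ D.feasSecond H ∧ D.auxLaw w.1 w.2.1 w.2.2 ∈ D.inputSet}

/-- The maximal output admissible invariant set. -/
def maxAdm (H : List ℕ) : Set ((Fin nx → ℝ) × (Fin nx → ℝ) × (Fin m → ℝ)) :=
  {w | ∀ k : ℕ, D.auxStep^[k] w ∈ D.auxConstr H}

/-- The usual approximation of the maximal output admissible set: in addition, the steady state
towards which the extended system evolves has to satisfy the tightened constraints. -/
def maxAdmApprox (H : List ℕ) : Set ((Fin nx → ℝ) × (Fin nx → ℝ) × (Fin m → ℝ)) :=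
  {w | w ∈ D.maxAdm H ∧ (w.2.1, w.2.1, w.2.2) ∈ D.tight.auxConstr H}

/-- `p` satisfies the constraints of the tracking problem with initial state `x`. -/
structure IsFeasible (H : List ℕ) (x : Fin nx → ℝ) (p : Plan nx m) : Prop where
  init : p.state 0 = x
  dyn : ∀ k < H.sum, p.state (k + 1) =
    D.stepA (stepMult H k) *ᵥ p.state k + D.stepB (stepMult H k) *ᵥ p.input k
  state_mem : ∀ k ≤ H.sum, p.state k ∈ D.stateSet
  input_mem : ∀ k < H.sum, p.input k ∈ D.inputSet
  terminal : (p.state (firstLen H), p.xbar, p.ubar) ∈ D.maxAdmApprox H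
  steady : D.IsSteady p.xbar p.ubar

/-- The tracking cost for the reference `r`. -/
def cost (H : List ℕ) (r : Fin nx → ℝ) (p : Plan nx m) : ℝ :=
  (∑ k ∈ Finset.range H.sum,
    (qform ((stepMult H k : ℝ) • D.Q) (p.state k - p.xbar) +
      qform ((stepMult H k : ℝ) • D.R) (p.input k - p.ubar))) +
  qform D.P (p.state H.sum - p.xbar) + qform D.T (p.xbar - r)

/-- The tracking problem with initial state `x` is feasible. -/
def ProblemFeasible (H : List ℕ) (x : Fin nx → ℝ) : Prop := ∃ p, D.IsFeasible H x p

/-- `p` is an optimal solution of the tracking problem with initial state `x`, reference `r`. -/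
def IsSolution (H : List ℕ) (x r : Fin nx → ℝ) (p : Plan nx m) : Prop :=
  D.IsFeasible H x p ∧ ∀ p', D.IsFeasible H x p' → D.cost H r p ≤ D.cost H r p'

/-- The input prescribed by packet `p`, `k` steps after its time index, if the state is `x`:
the buffered input while there is one, and the auxiliary law afterwards. -/
def packetInput (H : List ℕ) (p : Plan nx m) (k : ℕ) (x : Fin nx → ℝ) : Fin m → ℝ :=
  if k < firstLen H then p.input k else D.auxLaw x p.xbar p.ubar

end Data

/-- The signals of one run of the networked control system. -/
structure Run (nx m : ℕ) where
  /-- plant state -/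
  x : ℕ → Fin nx → ℝ
  /-- plant input -/
  u : ℕ → Fin m → ℝ
  /-- `xhat t` is the one-step-ahead estimate of `x t` made from the information of time `t - 1` -/
  xhat : ℕ → Fin nx → ℝ
  /-- `plan t` is the plan in the controller packet for time `t`; for `t = 0`, the initial buffer -/
  plan : ℕ → Plan nx m
  /-- `q t` is the time stamp in the controller packet for time `t`: the last time `< t` at which
  a plant packet was available to the controller -/
  q : ℕ → ℕ
  /-- `s t` is the index of the last consistent controller packet received up to time `t` -/
  s : ℕ → ℕ

/-- The consistency test at time `t` for a packet with time stamp `q`: the packet is available,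
and so are all the packets `q + 1, q + 1 + n, …` up to time `t`. -/
def Consistent (n : ℕ) (θ : ℕ → Bool) (q t : ℕ) : Prop :=
  θ t = true ∧ ∀ k ≤ (t - q - 1) / n, θ (q + 1 + k * n) = true

/-- The state estimate at time `t` after a possible reception of a plant packet. -/
def Run.xcur {nx m : ℕ} (ρ : Run nx m) (γ : ℕ → Bool) (t : ℕ) : Fin nx → ℝ :=
  if γ t then ρ.x t else ρ.xhat t

/-- The input which the estimator assumes at time `t`: the true one if a plant packet is available,
and otherwise the input of the most recently sent packet. -/
def Run.ucur {nx m cx cu : ℕ} (ρ : Run nx m) (D : Data nx m cx cu) (H : List ℕ) (n : ℕ)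
    (γ : ℕ → Bool) (t : ℕ) : Fin m → ℝ :=
  if γ t then ρ.u t else D.packetInput H (ρ.plan (t - t % n)) (t % n) (ρ.xcur γ t)

/-- `ρ` is a run of the closed loop with communication-rate parameter `n`, constant reference `r`
and packet availabilities `γ` (plant to controller) and `θ` (controller to plant). The initial
values of the state, the estimate, the time stamps and the buffer are arbitrary. -/
structure IsClosedLoop {nx m cx cu : ℕ} (D : Data nx m cx cu) (H : List ℕ) (n : ℕ)
    (r : Fin nx → ℝ) (γ θ : ℕ → Bool) (ρ : Run nx m) : Prop where
  /-- The plant packet of time `t` is only sent if `t + 1` is a multiple of `n`. -/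
  plant_sends : ∀ t, γ t = true → n ∣ t + 1
  /-- The controller packet for time `t` is only sent if `t` is a multiple of `n`. -/
  ctrl_sends : ∀ t, θ t = true → n ∣ t
  plant : ∀ t, ρ.x (t + 1) = D.A *ᵥ ρ.x t + D.B *ᵥ ρ.u t
  estimator : ∀ t, ρ.xhat (t + 1) = D.A *ᵥ ρ.xcur γ t + D.B *ᵥ ρ.ucur D H n γ t
  stamp : ∀ t, ρ.q (t + 1) = if γ t then t else ρ.q t
  /-- At each sending instant the controller solves the tracking problem at the predicted state.
  (If it is infeasible, nothing is prescribed.) -/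
  solve : ∀ t, n ∣ t + 1 → D.ProblemFeasible H (ρ.xhat (t + 1)) →
    D.IsSolution H (ρ.xhat (t + 1)) r (ρ.plan (t + 1))
  accept : ∀ t, Consistent n θ (ρ.q (t + 1)) (t + 1) → ρ.s (t + 1) = t + 1
  keep : ∀ t, ¬ Consistent n θ (ρ.q (t + 1)) (t + 1) → ρ.s (t + 1) = ρ.s t
  /-- The smart actuator law. -/
  actuator : ∀ t, ρ.u t = D.packetInput H (ρ.plan (ρ.s t)) (t - ρ.s t) (ρ.x t)

end NetMPC

end

/-! The argument is pathwise: probability enters only through the intersection of three almost sure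
events. On a fixed path, a consistent packet was computed from the exact state
(`xhat_eq_of_consistent`), because the actuator applied just the inputs the estimator assumed since
the last plant reception.

Take as Lyapunov function the cost `J t` of what remains of the buffered plan. The remainder,
continued by the auxiliary law, is feasible at the next state, and by the Lyapunov equation for `P`
it costs exactly one stage less (`cost_shift`). A newly accepted optimal plan costs no more than
this remainder. Hence `J` decreases to a limit, and the distance from the state to the current
artificial steady state tends to `0`.

It remains to exclude an artificial steady state stuck away from `r`. At an optimal plan with `x`
near `xbar`, moving `xbar` a fraction `l` towards `r` is feasible thanks to the margins. It saves at
least order `l * ‖xbar - r‖ ^ 2` in the offset cost, while the cost of steering to the new steady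
state is at most of order `‖x - xbar‖ ^ 2 + l ^ 2 * ‖xbar - r‖ ^ 2`. For small `l`, optimality
forces `J ≤ C * ‖x - xbar‖ ^ 2` (`exists_cost_le_of_isSolution`). The network delivers optimal plans
infinitely often, so the limit of `J` is `0`, and both `xbar` and the state tend to `r`. -/

noncomputable section

namespace NetMPC

/-! ### Powers of elements and matrices of spectral radius below one -/

section Gelfand

open scoped NNReal ENNReal

/-- By Gelfand's formula `‖a ^ k‖ ^ (1 / k)` tends to the spectral radius, so `‖a ^ k‖` is
eventually below `c ^ k` for some `c < 1`. -/
theorem tendsto_pow_zero_of_forall_spectrum_lt_one {A : Type*} [NormedRing A] [NormedAlgebra ℂ A]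
    [CompleteSpace A] (a : A) (h : ∀ z ∈ spectrum ℂ a, ‖z‖ < 1) :
    Tendsto (fun k : ℕ => a ^ k) atTop (𝓝 0) := by
  -- The zero ring has empty spectrum and is treated apart; it occurs for matrices of size `0`.
  cases subsingleton_or_nontrivial A with
  | inl hs =>
    have : (fun k : ℕ => a ^ k) = fun _ => 0 := funext fun k => Subsingleton.elim _ _
    rw [this]
    exact tendsto_const_nhds
  | inr hn =>
    have hρ : spectralRadius ℂ a < (1 : ℝ≥0) :=
      spectrum.spectralRadius_lt_of_forall_lt a fun z hz => by
        have := h z hz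
        rwa [← NNReal.coe_lt_coe, coe_nnnorm, NNReal.coe_one]
    obtain ⟨c, hc, hc1⟩ := ENNReal.lt_iff_exists_nnreal_btwn.1 hρ
    have hc1' : c < 1 := by exact_mod_cast hc1
    have hev := (spectrum.pow_nnnorm_pow_one_div_tendsto_nhds_spectralRadius a).eventually
      (gt_mem_nhds hc)
    have hpow : Tendsto (fun k : ℕ => (c : ℝ) ^ k) atTop (𝓝 0) :=
      tendsto_pow_atTop_nhds_zero_of_lt_one c.2 (by exact_mod_cast hc1')
    refine squeeze_zero_norm' ?_ hpow
    filter_upwards [hev, eventually_gt_atTop 0] with k hk hk0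
    have hk0' : (0 : ℝ) < k := by exact_mod_cast hk0
    have h1 := ENNReal.rpow_le_rpow hk.le hk0'.le
    rw [← ENNReal.rpow_mul, one_div, inv_mul_cancel₀ hk0'.ne', ENNReal.rpow_one,
      ENNReal.rpow_natCast] at h1
    have h2 : ‖a ^ k‖₊ ≤ c ^ k := by exact_mod_cast h1
    exact_mod_cast h2

end Gelfand

section Powers

variable {d : ℕ}

theorem IsSchur.tendsto_pow_apply {M : Matrix (Fin d) (Fin d) ℝ} (hM : IsSchur M) (i j : Fin d) :
    Tendsto (fun k : ℕ => (M ^ k) i j) atTop (𝓝 0) := by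
  -- The norm is auxiliary: the conclusion concerns entries, which depend continuously on the matrix
  -- in finite dimension.
  let _ : NormedRing (Matrix (Fin d) (Fin d) ℂ) := Matrix.linftyOpNormedRing
  let _ : NormedAlgebra ℂ (Matrix (Fin d) (Fin d) ℂ) := Matrix.linftyOpNormedAlgebra
  have : CompleteSpace (Matrix (Fin d) (Fin d) ℂ) := FiniteDimensional.complete ℂ _
  have h := tendsto_pow_zero_of_forall_spectrum_lt_one (M.map (algebraMap ℝ ℂ)) hM
  have hcont : Continuous fun X : Matrix (Fin d) (Fin d) ℂ => (X i j).re :=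
    LinearMap.continuous_of_finiteDimensional
      (Complex.reLm ∘ₗ (Matrix.entryLinearMap ℝ ℂ i j))
  have h2 := (hcont.tendsto 0).comp h
  refine (h2.congr fun k => ?_).trans (by simp)
  rw [Function.comp_apply, ← Matrix.map_pow]
  simp

theorem IsSchur.tendsto_pow_mulVec {M : Matrix (Fin d) (Fin d) ℝ} (hM : IsSchur M)
    (v : Fin d → ℝ) : Tendsto (fun k : ℕ => (M ^ k) *ᵥ v) atTop (𝓝 0) := by
  refine tendsto_pi_nhds.2 fun i => ?_
  have : Tendsto (fun k : ℕ => ∑ j, (M ^ k) i j * v j) atTop (𝓝 (∑ j : Fin d, 0 * v j)) :=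
    tendsto_finsetSum _ fun j _ => (hM.tendsto_pow_apply i j).mul_const _
  simpa [Matrix.mulVec, dotProduct] using this

theorem IsSchur.exists_norm_pow_mulVec_le {M : Matrix (Fin d) (Fin d) ℝ} (hM : IsSchur M) :
    ∃ C, 0 < C ∧ ∀ (k : ℕ) (v : Fin d → ℝ), ‖(M ^ k) *ᵥ v‖ ≤ C * ‖v‖ := by
  have hb : ∀ i j, ∃ C, ∀ k : ℕ, |(M ^ k) i j| ≤ C := fun i j => by
    obtain ⟨C, hC⟩ := (hM.tendsto_pow_apply i j).norm.bddAbove_range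
    exact ⟨C, fun k => hC ⟨k, rfl⟩⟩
  choose C hC using hb
  have hC0 : ∀ i j, 0 ≤ C i j := fun i j => (abs_nonneg _).trans (hC i j 0)
  have hS : 0 ≤ ∑ i, ∑ j, C i j :=
    Finset.sum_nonneg fun i _ => Finset.sum_nonneg fun j _ => hC0 i j
  refine ⟨∑ i, ∑ j, C i j + 1, by linarith, fun k v => ?_⟩
  refine (pi_norm_le_iff_of_nonneg (by positivity)).2 fun i => ?_
  calc ‖((M ^ k) *ᵥ v) i‖ ≤ ∑ j, ‖(M ^ k) i j * v j‖ := norm_sum_le Finset.univ fun j => (M ^ k) i j * v j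
    _ ≤ ∑ j, C i j * ‖v‖ := Finset.sum_le_sum fun j _ => by
        rw [norm_mul]
        exact mul_le_mul (hC i j k) (norm_le_pi_norm v j) (norm_nonneg _) (hC0 i j)
    _ = (∑ j, C i j) * ‖v‖ := (Finset.sum_mul _ _ _).symm
    _ ≤ (∑ i, ∑ j, C i j + 1) * ‖v‖ := by
        refine mul_le_mul_of_nonneg_right ?_ (norm_nonneg _)
        have := Finset.single_le_sum (f := fun i => ∑ j, C i j)
          (fun i _ => Finset.sum_nonneg fun j _ => hC0 i j) (Finset.mem_univ i)
        linarith

end Powers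

/-! ### Quadratic forms compared with the squared norm -/

section QuadraticForm

variable {d : ℕ}

theorem qform_zero (M : Matrix (Fin d) (Fin d) ℝ) : qform M 0 = 0 := by simp [qform]

theorem qform_smul (M : Matrix (Fin d) (Fin d) ℝ) (a : ℝ) (v : Fin d → ℝ) :
    qform M (a • v) = a ^ 2 * qform M v := by
  simp only [qform, Matrix.mulVec_smul, smul_dotProduct, dotProduct_smul, smul_eq_mul]
  ring

theorem continuous_qform (M : Matrix (Fin d) (Fin d) ℝ) : Continuous (qform M) := by
  unfold qform
  fun_prop

theorem qform_pos {M : Matrix (Fin d) (Fin d) ℝ} (hM : M.PosDef) {v : Fin d → ℝ} (hv : v ≠ 0) :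
    0 < qform M v := by
  simpa [qform] using hM.dotProduct_mulVec_pos hv

theorem qform_nonneg {M : Matrix (Fin d) (Fin d) ℝ} (hM : M.PosDef) (v : Fin d → ℝ) :
    0 ≤ qform M v := by
  rcases eq_or_ne v 0 with rfl | hv
  · simp [qform_zero]
  · exact (qform_pos hM hv).le

theorem qform_eq_norm_sq_mul (M : Matrix (Fin d) (Fin d) ℝ) {v : Fin d → ℝ} (hv : v ≠ 0) :
    qform M v = ‖v‖ ^ 2 * qform M (‖v‖⁻¹ • v) := by
  have : ‖v‖ ≠ 0 := norm_ne_zero_iff.2 hv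
  rw [qform_smul]
  field_simp

theorem exists_qform_le (M : Matrix (Fin d) (Fin d) ℝ) :
    ∃ C, 0 < C ∧ ∀ v, qform M v ≤ C * ‖v‖ ^ 2 := by
  obtain ⟨C, hC⟩ := (isCompact_closedBall (0 : Fin d → ℝ) 1).exists_bound_of_continuousOn
    (continuous_qform M).continuousOn
  have hC0 : 0 ≤ C := (norm_nonneg _).trans (hC 0 (by simp))
  refine ⟨C + 1, by linarith, fun v => ?_⟩
  rcases eq_or_ne v 0 with rfl | hv
  · simp [qform_zero]
  · have h0 : ‖v‖ ≠ 0 := norm_ne_zero_iff.2 hv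
    have h1 := (le_abs_self _).trans (hC (‖v‖⁻¹ • v) (by simp [norm_smul, h0]))
    rw [qform_eq_norm_sq_mul M hv]
    nlinarith [sq_nonneg ‖v‖]

theorem exists_le_qform {M : Matrix (Fin d) (Fin d) ℝ} (hM : M.PosDef) :
    ∃ c, 0 < c ∧ ∀ v, c * ‖v‖ ^ 2 ≤ qform M v := by
  -- The unit sphere is empty only in dimension `0`; otherwise its compactness gives a positive
  -- minimum.
  rcases (Metric.sphere (0 : Fin d → ℝ) 1).eq_empty_or_nonempty with he | hne
  · refine ⟨1, one_pos, fun v => ?_⟩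
    rcases eq_or_ne v 0 with rfl | hv
    · simp [qform_zero]
    · have h0 : ‖v‖ ≠ 0 := norm_ne_zero_iff.2 hv
      have : ‖v‖⁻¹ • v ∈ Metric.sphere (0 : Fin d → ℝ) 1 := by simp [norm_smul, h0]
      simp [he] at this
  · obtain ⟨w, hw, hmin⟩ := (isCompact_sphere (0 : Fin d → ℝ) 1).exists_isMinOn hne
      (continuous_qform M).continuousOn
    have hw0 : w ≠ 0 := by rintro rfl; simp at hw
    refine ⟨qform M w, qform_pos hM hw0, fun v => ?_⟩
    rcases eq_or_ne v 0 with rfl | hv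
    · simp [qform_zero]
    · have h0 : ‖v‖ ≠ 0 := norm_ne_zero_iff.2 hv
      have h1 : qform M w ≤ qform M (‖v‖⁻¹ • v) := hmin (by simp [norm_smul, h0])
      rw [qform_eq_norm_sq_mul M hv, mul_comm]
      gcongr

end QuadraticForm

namespace Data

variable {nx m cx cu : ℕ} {D : Data nx m cx cu}

theorem qform_eq_of_lyapunov
    (hP : D.P = (D.A + D.B * D.K)ᵀ * D.P * (D.A + D.B * D.K) + D.Q + D.Kᵀ * D.R * D.K)
    (v : Fin nx → ℝ) :
    qform D.P v = qform D.P ((D.A + D.B * D.K) *ᵥ v) + qform D.Q v + qform D.R (D.K *ᵥ v) := by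
  conv_lhs => rw [hP]
  simp only [qform, Matrix.add_mulVec (_ + _), Matrix.add_mulVec (_ * _ * _) D.Q,
    dotProduct_add, ← Matrix.mulVec_mulVec _ (_ * _), ← Matrix.mulVec_mulVec _ (_)ᵀ,
    Matrix.dotProduct_mulVec _ (_)ᵀ, Matrix.vecMul_transpose]

/-- Positivity of `P` is not assumed but derived: its form does not increase along the closed loop
`A + B K`, and tends to `0` there. -/
theorem qform_nonneg_of_lyapunov (hQ : D.Q.PosDef) (hR : D.R.PosDef)
    (hK : IsSchur (D.A + D.B * D.K))
    (hP : D.P = (D.A + D.B * D.K)ᵀ * D.P * (D.A + D.B * D.K) + D.Q + D.Kᵀ * D.R * D.K)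
    (v : Fin nx → ℝ) : 0 ≤ qform D.P v := by
  have hle : ∀ k : ℕ, qform D.P ((D.A + D.B * D.K) ^ k *ᵥ v) ≤ qform D.P v := fun k => by
    induction k with
    | zero => simp
    | succ k ih =>
      have := qform_eq_of_lyapunov hP ((D.A + D.B * D.K) ^ k *ᵥ v)
      rw [Matrix.mulVec_mulVec, ← pow_succ'] at this
      linarith [qform_nonneg hQ ((D.A + D.B * D.K) ^ k *ᵥ v),
        qform_nonneg hR (D.K *ᵥ ((D.A + D.B * D.K) ^ k *ᵥ v))]
  have hlim := ((continuous_qform D.P).tendsto 0).comp (hK.tendsto_pow_mulVec v)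
  rw [qform_zero] at hlim
  exact le_of_tendsto' hlim hle

end Data

/-! ### Admissible infinite plans, their shifts and their costs -/

section Plan

variable {nx m cx cu : ℕ}

/-- The plan which remains after one step. -/
def Plan.shift (p : Plan nx m) : Plan nx m where
  state k := p.state (k + 1)
  input k := p.input (k + 1)
  xbar := p.xbar
  ubar := p.ubar

/-- The infinite continuation of a plan of length `N` by the auxiliary law. -/
def Plan.extend (D : Data nx m cx cu) (N : ℕ) (p : Plan nx m) : Plan nx m where
  state k := if k ≤ N then p.state k else
    (D.auxStep^[k - N] (p.state N, p.xbar, p.ubar)).1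
  input k := if k < N then p.input k else
    D.auxLaw (D.auxStep^[k - N] (p.state N, p.xbar, p.ubar)).1 p.xbar p.ubar
  xbar := p.xbar
  ubar := p.ubar

theorem Plan.iterate_shift_state (p : Plan nx m) (j k : ℕ) :
    (Plan.shift^[j] p).state k = p.state (k + j) := by
  induction j generalizing k with
  | zero => rfl
  | succ j ih =>
    rw [Function.iterate_succ_apply']
    exact (ih (k + 1)).trans (by congr 1; omega)

theorem Plan.iterate_shift_input (p : Plan nx m) (j k : ℕ) :
    (Plan.shift^[j] p).input k = p.input (k + j) := by
  induction j generalizing k with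
  | zero => rfl
  | succ j ih =>
    rw [Function.iterate_succ_apply']
    exact (ih (k + 1)).trans (by congr 1; omega)

namespace Data

variable {D : Data nx m cx cu} {N : ℕ}

/-- `p` is an infinite admissible trajectory which follows the auxiliary law from step `N` on,
with an artificial steady state satisfying the tightened constraints. -/
structure IsAdmissible (D : Data nx m cx cu) (N : ℕ) (p : Plan nx m) : Prop where
  dyn : ∀ k, p.state (k + 1) = D.A *ᵥ p.state k + D.B *ᵥ p.input k
  state_mem : ∀ k, p.state k ∈ D.stateSet
  input_mem : ∀ k, p.input k ∈ D.inputSet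
  input_eq : ∀ k, N ≤ k → p.input k = D.auxLaw (p.state k) p.xbar p.ubar
  steady : D.IsSteady p.xbar p.ubar
  xbar_mem : p.xbar ∈ D.tight.stateSet
  ubar_mem : p.ubar ∈ D.tight.inputSet

theorem auxStep_eq (x xbar : Fin nx → ℝ) (ubar : Fin m → ℝ) :
    D.auxStep (x, xbar, ubar) = (D.A *ᵥ x + D.B *ᵥ D.auxLaw x xbar ubar, xbar, ubar) := by
  simp only [auxStep, auxLaw, Matrix.add_mulVec, Matrix.mulVec_add, Matrix.mulVec_sub,
    ← Matrix.mulVec_mulVec]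
  congr 1
  abel

theorem auxLaw_self (xbar : Fin nx → ℝ) (ubar : Fin m → ℝ) : D.auxLaw xbar xbar ubar = ubar := by
  simp [auxLaw]

theorem IsSteady.closedLoop_sub {xbar : Fin nx → ℝ} {ubar : Fin m → ℝ}
    (h : D.IsSteady xbar ubar) (x : Fin nx → ℝ) :
    D.A *ᵥ x + D.B *ᵥ D.auxLaw x xbar ubar - xbar = (D.A + D.B * D.K) *ᵥ (x - xbar) := by
  have h' : D.B *ᵥ ubar = xbar - D.A *ᵥ xbar := by
    have := h
    rw [IsSteady, Matrix.sub_mulVec, Matrix.one_mulVec] at this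
    rw [← sub_eq_zero, ← this]
    abel
  simp only [auxLaw, Matrix.add_mulVec, Matrix.mulVec_add, Matrix.mulVec_sub,
    ← Matrix.mulVec_mulVec, h']
  abel

theorem iterate_auxStep_snd (w : (Fin nx → ℝ) × (Fin nx → ℝ) × (Fin m → ℝ)) (k : ℕ) :
    (D.auxStep^[k] w).2 = w.2 := by
  induction k with
  | zero => rfl
  | succ k ih =>
    rw [Function.iterate_succ_apply', ← ih]
    rfl

theorem iterate_auxStep_succ_fst (x xbar : Fin nx → ℝ) (ubar : Fin m → ℝ) (k : ℕ) :
    (D.auxStep^[k + 1] (x, xbar, ubar)).1 =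
      D.A *ᵥ (D.auxStep^[k] (x, xbar, ubar)).1 +
        D.B *ᵥ D.auxLaw (D.auxStep^[k] (x, xbar, ubar)).1 xbar ubar := by
  have h := D.iterate_auxStep_snd (x, xbar, ubar) k
  rw [Function.iterate_succ_apply',
    show D.auxStep^[k] (x, xbar, ubar) = ((D.auxStep^[k] (x, xbar, ubar)).1, xbar, ubar) from
      Prod.ext rfl h, auxStep_eq]

theorem stepMult_singleton {k : ℕ} (hk : k < N) : stepMult [N] k = 1 := by
  simp [stepMult, stepMultFrom, hk]

theorem feasSecond_singleton : D.feasSecond [N] = D.stateSet := by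
  ext x
  refine ⟨fun h => h.1, fun h => ⟨h, fun _ => x, fun _ => 0, rfl, fun k h1 h2 => ?_⟩⟩
  simp [firstLen] at h1 h2
  omega

theorem stepA_one : D.stepA 1 = D.A := by simp [stepA]

theorem stepB_one : D.stepB 1 = D.B := by simp [stepB]

theorem cost_singleton (r : Fin nx → ℝ) (p : Plan nx m) :
    D.cost [N] r p = (∑ k ∈ Finset.range N,
      (qform D.Q (p.state k - p.xbar) + qform D.R (p.input k - p.ubar))) +
      qform D.P (p.state N - p.xbar) + qform D.T (p.xbar - r) := by
  have : ∀ k ∈ Finset.range N,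
      (qform ((stepMult [N] k : ℝ) • D.Q) (p.state k - p.xbar) +
        qform ((stepMult [N] k : ℝ) • D.R) (p.input k - p.ubar)) =
      qform D.Q (p.state k - p.xbar) + qform D.R (p.input k - p.ubar) := fun k hk => by
    simp [stepMult_singleton (Finset.mem_range.1 hk)]
  simp only [cost, List.sum_singleton, Finset.sum_congr rfl this]

/-- From step `N` on the plan follows the auxiliary law, so the iterates of `auxStep` started at
step `N` retrace it. This gives the terminal condition. -/
theorem IsAdmissible.isFeasible {p : Plan nx m} (h : D.IsAdmissible N p) :
    D.IsFeasible [N] (p.state 0) p where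
  init := rfl
  dyn k hk := by
    rw [List.sum_singleton] at hk
    rw [stepMult_singleton hk, stepA_one, stepB_one]
    exact h.dyn k
  state_mem k _ := h.state_mem k
  input_mem k _ := h.input_mem k
  terminal := by
    have hit : ∀ k, (D.auxStep^[k] (p.state N, p.xbar, p.ubar)).1 = p.state (N + k) := fun k => by
      induction k with
      | zero => rfl
      | succ k ih =>
        rw [iterate_auxStep_succ_fst, ih, ← h.input_eq _ (by omega), ← h.dyn]
        rfl
    refine ⟨fun k => ⟨?_, ?_⟩, ?_, ?_⟩
    · rw [feasSecond_singleton]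
      exact (hit k).symm ▸ h.state_mem _
    · rw [iterate_auxStep_snd]
      have := h.input_mem (N + k)
      rw [h.input_eq _ (by omega)] at this
      exact (hit k).symm ▸ this
    · rw [feasSecond_singleton]
      exact h.xbar_mem
    · rw [auxLaw_self]
      exact h.ubar_mem
  steady := h.steady

theorem IsFeasible.isAdmissible_extend {x : Fin nx → ℝ} {p : Plan nx m}
    (h : D.IsFeasible [N] x p) : D.IsAdmissible N (p.extend D N) where
  dyn k := by
    rcases lt_trichotomy k N with hk | rfl | hk
    · have := h.dyn k (by simpa using hk)
      rw [stepMult_singleton hk, stepA_one, stepB_one] at this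
      simpa [Plan.extend, hk, hk.le, Nat.succ_le_iff.2 hk] using this
    · simp [Plan.extend, auxStep_eq]
    · have e : k + 1 - N = k - N + 1 := by omega
      simp only [Plan.extend, if_neg hk.not_gt, if_neg hk.not_ge,
        if_neg (show ¬ k + 1 ≤ N by omega), e, iterate_auxStep_succ_fst]
  state_mem k := by
    by_cases hk : k ≤ N
    · simpa [Plan.extend, hk] using h.state_mem k (by simpa using hk)
    · simp only [Plan.extend, if_neg hk]
      exact (h.terminal.1 (k - N)).1.1
  input_mem k := by
    by_cases hk : k < N
    · simpa [Plan.extend, hk] using h.input_mem k (by simpa using hk)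
    · simp only [Plan.extend, if_neg hk]
      have := (h.terminal.1 (k - N)).2
      rw [iterate_auxStep_snd] at this
      exact this
  input_eq k hk := by
    rcases hk.eq_or_lt with rfl | hk
    · simp [Plan.extend]
    · simp [Plan.extend, hk.not_gt, hk.not_ge]
  steady := h.steady
  xbar_mem := h.terminal.2.1.1
  ubar_mem := by
    have : D.tight.auxLaw p.xbar p.xbar p.ubar ∈ D.tight.inputSet := h.terminal.2.2
    rwa [auxLaw_self] at this

theorem cost_extend (r : Fin nx → ℝ) (p : Plan nx m) :
    D.cost [N] r (p.extend D N) = D.cost [N] r p := by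
  rw [cost_singleton, cost_singleton]
  have : ∀ k ∈ Finset.range N, qform D.Q ((p.extend D N).state k - (p.extend D N).xbar) +
      qform D.R ((p.extend D N).input k - (p.extend D N).ubar) =
      qform D.Q (p.state k - p.xbar) + qform D.R (p.input k - p.ubar) := fun k hk => by
    have := Finset.mem_range.1 hk
    simp [Plan.extend, this, this.le]
  rw [Finset.sum_congr rfl this]
  simp [Plan.extend]

theorem IsFeasible.extend_state_zero {x : Fin nx → ℝ} {p : Plan nx m}
    (h : D.IsFeasible [N] x p) : (p.extend D N).state 0 = x := by
  simp [Plan.extend, h.init]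

/-- On the extended trajectory the smart actuator reproduces the extended inputs, even after the
buffer has run out. -/
theorem IsFeasible.packetInput_extend {x : Fin nx → ℝ} {p : Plan nx m}
    (h : D.IsFeasible [N] x p) (k : ℕ) :
    D.packetInput [N] p k ((p.extend D N).state k) = (p.extend D N).input k := by
  by_cases hk : k < N
  · simp [packetInput, firstLen, Plan.extend, hk]
  · rw [h.isAdmissible_extend.input_eq k (not_lt.1 hk)]
    simp [packetInput, firstLen, hk, Plan.extend]

/-- Recursive feasibility: since plans are infinite, nothing has to be appended at the end of the
horizon. -/
theorem IsAdmissible.shift {p : Plan nx m} (h : D.IsAdmissible N p) :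
    D.IsAdmissible N p.shift where
  dyn k := h.dyn (k + 1)
  state_mem k := h.state_mem (k + 1)
  input_mem k := h.input_mem (k + 1)
  input_eq k hk := h.input_eq (k + 1) (by omega)
  steady := h.steady
  xbar_mem := h.xbar_mem
  ubar_mem := h.ubar_mem

theorem IsAdmissible.iterate_shift {p : Plan nx m} (h : D.IsAdmissible N p) (j : ℕ) :
    D.IsAdmissible N (Plan.shift^[j] p) := by
  induction j with
  | zero => exact h
  | succ j ih =>
    rw [Function.iterate_succ_apply']
    exact ih.shift

/-- The shift drops the stage cost at step `0` and gains the one at step `N`; the Lyapunov equation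
at the error of step `N` makes the latter cancel against the change of terminal cost. -/
theorem IsAdmissible.cost_shift
    (hP : D.P = (D.A + D.B * D.K)ᵀ * D.P * (D.A + D.B * D.K) + D.Q + D.Kᵀ * D.R * D.K)
    {p : Plan nx m} (h : D.IsAdmissible N p) (r : Fin nx → ℝ) :
    D.cost [N] r p.shift + (qform D.Q (p.state 0 - p.xbar) + qform D.R (p.input 0 - p.ubar)) =
      D.cost [N] r p := by
  have h1 : p.state (N + 1) - p.xbar = (D.A + D.B * D.K) *ᵥ (p.state N - p.xbar) := by
    rw [h.dyn, h.input_eq N le_rfl, h.steady.closedLoop_sub]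
  have h2 : p.input N - p.ubar = D.K *ᵥ (p.state N - p.xbar) := by
    rw [h.input_eq N le_rfl, auxLaw, add_sub_cancel_left]
  have h3 := qform_eq_of_lyapunov hP (p.state N - p.xbar)
  rw [← h1, ← h2] at h3
  have h4 := Finset.sum_range_succ'
    (fun k => qform D.Q (p.state k - p.xbar) + qform D.R (p.input k - p.ubar)) N
  rw [Finset.sum_range_succ] at h4
  rw [cost_singleton, cost_singleton]
  simp only [Plan.shift]
  linarith

theorem le_cost (hQ : D.Q.PosDef) (hR : D.R.PosDef) (hK : IsSchur (D.A + D.B * D.K))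
    (hP : D.P = (D.A + D.B * D.K)ᵀ * D.P * (D.A + D.B * D.K) + D.Q + D.Kᵀ * D.R * D.K)
    (r : Fin nx → ℝ) (p : Plan nx m) : qform D.T (p.xbar - r) ≤ D.cost [N] r p := by
  rw [cost_singleton]
  have h1 := qform_nonneg_of_lyapunov hQ hR hK hP (p.state N - p.xbar)
  have h2 : 0 ≤ ∑ k ∈ Finset.range N,
      (qform D.Q (p.state k - p.xbar) + qform D.R (p.input k - p.ubar)) :=
    Finset.sum_nonneg fun k _ => add_nonneg (qform_nonneg hQ _) (qform_nonneg hR _)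
  linarith

/-- The trajectory from `x` under the auxiliary law with steady state `(xbar, ubar)`. -/
def auxPlan (D : Data nx m cx cu) (x xbar : Fin nx → ℝ) (ubar : Fin m → ℝ) : Plan nx m where
  state k := xbar + (D.A + D.B * D.K) ^ k *ᵥ (x - xbar)
  input k := ubar + D.K *ᵥ ((D.A + D.B * D.K) ^ k *ᵥ (x - xbar))
  xbar := xbar
  ubar := ubar

theorem auxPlan_state_zero (x xbar : Fin nx → ℝ) (ubar : Fin m → ℝ) :
    (D.auxPlan x xbar ubar).state 0 = x := by simp [auxPlan]

/-- The `P`-form is the exact cost of following the auxiliary law, whatever the horizon. -/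
theorem cost_auxPlan
    (hP : D.P = (D.A + D.B * D.K)ᵀ * D.P * (D.A + D.B * D.K) + D.Q + D.Kᵀ * D.R * D.K)
    (x xbar r : Fin nx → ℝ) (ubar : Fin m → ℝ) :
    D.cost [N] r (D.auxPlan x xbar ubar) = qform D.P (x - xbar) + qform D.T (xbar - r) := by
  rw [cost_singleton]
  simp only [auxPlan, add_sub_cancel_left]
  congr 1
  induction N with
  | zero => simp
  | succ N ih =>
    have h := qform_eq_of_lyapunov hP ((D.A + D.B * D.K) ^ N *ᵥ (x - xbar))
    rw [Matrix.mulVec_mulVec, ← pow_succ'] at h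
    rw [← ih, h, Finset.sum_range_succ]
    ring

theorem exists_forall_norm_le_mulVec_le {c d : ℕ} (M : Matrix (Fin c) (Fin d) ℝ) {e : Fin c → ℝ}
    (he : ∀ i, 0 < e i) : ∃ δ, 0 < δ ∧ ∀ v : Fin d → ℝ, ‖v‖ ≤ δ → M *ᵥ v ≤ e := by
  have hcont : Continuous fun v : Fin d → ℝ => M *ᵥ v := by fun_prop
  have hev : ∀ᶠ v in 𝓝 (0 : Fin d → ℝ), M *ᵥ v ≤ e := by
    have : ∀ i, ∀ᶠ v in 𝓝 (0 : Fin d → ℝ), (M *ᵥ v) i < e i := fun i =>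
      ((continuous_apply i).comp hcont).continuousAt.eventually_lt continuousAt_const
        (by simpa using he i)
    filter_upwards [eventually_all.2 this] with v hv i using (hv i).le
  obtain ⟨δ, hδ, h⟩ := Metric.nhds_basis_closedBall.eventually_iff.1 hev
  exact ⟨δ, hδ, fun v hv => h (by simpa using hv)⟩

/-- The margins make `δ` uniform in the steady state: powers of `A + B K` are bounded, so a small
initial error stays small enough for the margins to absorb it. -/
theorem exists_isAdmissible_auxPlan (hex : ∀ i, 0 < D.ex i) (heu : ∀ i, 0 < D.eu i)
    (hK : IsSchur (D.A + D.B * D.K)) :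
    ∃ δ, 0 < δ ∧ ∀ (x xbar : Fin nx → ℝ) (ubar : Fin m → ℝ), D.IsSteady xbar ubar →
      xbar ∈ D.tight.stateSet → ubar ∈ D.tight.inputSet → ‖x - xbar‖ ≤ δ →
      D.IsAdmissible N (D.auxPlan x xbar ubar) := by
  obtain ⟨C, hC, hpow⟩ := hK.exists_norm_pow_mulVec_le
  obtain ⟨δ₁, hδ₁, h₁⟩ := exists_forall_norm_le_mulVec_le D.Px hex
  obtain ⟨δ₂, hδ₂, h₂⟩ := exists_forall_norm_le_mulVec_le (D.Pu * D.K) heu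
  refine ⟨min δ₁ δ₂ / C, by positivity, fun x xbar ubar hs hx hu hδ => ?_⟩
  have hsmall : ∀ k : ℕ, ‖(D.A + D.B * D.K) ^ k *ᵥ (x - xbar)‖ ≤ min δ₁ δ₂ := fun k =>
    (hpow k _).trans (by rwa [le_div_iff₀' hC] at hδ)
  have hlaw : ∀ k, (D.auxPlan x xbar ubar).input k =
      D.auxLaw ((D.auxPlan x xbar ubar).state k) xbar ubar := fun k => by
    simp [auxPlan, auxLaw]
  refine ⟨fun k => ?_, fun k i => ?_, fun k i => ?_, fun k _ => hlaw k, hs, hx, hu⟩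
  · rw [← sub_left_inj, hlaw k, hs.closedLoop_sub]
    simp [auxPlan, pow_succ']
  · have ha : (D.Px *ᵥ xbar) i ≤ D.px i - D.ex i := hx i
    have hb := h₁ _ ((hsmall k).trans (min_le_left _ _)) i
    simp only [auxPlan, Matrix.mulVec_add, Pi.add_apply]
    linarith
  · have ha : (D.Pu *ᵥ ubar) i ≤ D.pu i - D.eu i := hu i
    have hb := h₂ _ ((hsmall k).trans (min_le_right _ _)) i
    rw [← Matrix.mulVec_mulVec] at hb
    simp only [auxPlan, Matrix.mulVec_add, Pi.add_apply]
    linarith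

end Data

end Plan

/-! ### Convergence of the cost and of the state -/

section Convergence

variable {nx m cx cu : ℕ} {D : Data nx m cx cu} {N : ℕ}

namespace Data

theorem IsSteady.convexComb {x y : Fin nx → ℝ} {u v : Fin m → ℝ} (h : D.IsSteady x u)
    (h' : D.IsSteady y v) (l : ℝ) :
    D.IsSteady ((1 - l) • x + l • y) ((1 - l) • u + l • v) := by
  have e : (D.A - 1) *ᵥ ((1 - l) • x + l • y) + D.B *ᵥ ((1 - l) • u + l • v) =
      (1 - l) • ((D.A - 1) *ᵥ x + D.B *ᵥ u) + l • ((D.A - 1) *ᵥ y + D.B *ᵥ v) := by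
    simp only [Matrix.mulVec_add, Matrix.mulVec_smul, smul_add]
    abel
  rw [IsSteady] at h h' ⊢
  rw [e, h, h', smul_zero, smul_zero, add_zero]

theorem mulVec_convexComb_le {c d : ℕ} {M : Matrix (Fin c) (Fin d) ℝ} {b : Fin c → ℝ}
    {x y : Fin d → ℝ} (hx : M *ᵥ x ≤ b) (hy : M *ᵥ y ≤ b) {l : ℝ} (h0 : 0 ≤ l) (h1 : l ≤ 1) :
    M *ᵥ ((1 - l) • x + l • y) ≤ b := fun i => by
  simp only [Matrix.mulVec_add, Matrix.mulVec_smul, Pi.add_apply, Pi.smul_apply, smul_eq_mul]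
  have := mul_le_mul_of_nonneg_left (hx i) (sub_nonneg.2 h1)
  have := mul_le_mul_of_nonneg_left (hy i) h0
  linarith

/-- If the state of an optimal plan is close to its artificial steady state, then the cost is
controlled by the distance between the two: otherwise it would pay to move the steady state towards
the reference. -/
theorem exists_cost_le_of_isSolution (hex : ∀ i, 0 < D.ex i) (heu : ∀ i, 0 < D.eu i)
    (hQ : D.Q.PosDef) (hR : D.R.PosDef) (hT : D.T.PosDef)
    (hK : IsSchur (D.A + D.B * D.K))
    (hP : D.P = (D.A + D.B * D.K)ᵀ * D.P * (D.A + D.B * D.K) + D.Q + D.Kᵀ * D.R * D.K)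
    {r : Fin nx → ℝ} {ur : Fin m → ℝ} (hr : D.IsSteady r ur) (hrx : r ∈ D.tight.stateSet)
    (hru : ur ∈ D.tight.inputSet) (b : ℝ) :
    ∃ δ, 0 < δ ∧ ∃ C, 0 < C ∧ ∀ x p, D.IsSolution [N] x r p → ‖x - p.xbar‖ ≤ δ →
      ‖p.xbar - r‖ ≤ b → D.cost [N] r p ≤ C * ‖x - p.xbar‖ ^ 2 := by
  obtain ⟨δ, hδ, hadm⟩ := exists_isAdmissible_auxPlan (N := N) hex heu hK
  obtain ⟨cT, hcT, hTl⟩ := exists_le_qform hT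
  obtain ⟨CT, hCT, hTu⟩ := exists_qform_le D.T
  obtain ⟨CP, hCP, hPu⟩ := exists_qform_le D.P
  -- With `4 * CP * l ≤ cT` the `l ^ 2` term of the steering cost is at most half of the saving; the
  -- last bound keeps the moved steady state within `δ` of `x`.
  obtain ⟨l, hl0, hl1, hlP, hlb⟩ : ∃ l : ℝ, 0 < l ∧ l ≤ 1 ∧ 4 * CP * l ≤ cT ∧
      l * (|b| + 1) ≤ δ / 2 := by
    refine ⟨min 1 (min (cT / (4 * CP)) (δ / 2 / (|b| + 1))), by positivity, min_le_left _ _, ?_, ?_⟩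
    · rw [← le_div_iff₀' (by positivity)]
      exact (min_le_right _ _).trans (min_le_left _ _)
    · rw [← le_div_iff₀ (by positivity)]
      exact (min_le_right _ _).trans (min_le_right _ _)
  refine ⟨δ / 2, by positivity, 2 * CP + (2 * CP + CT) * (4 * CP / (l * cT)), by positivity,
    fun x p hp hx hb => ?_⟩
  have hf := hp.1.isAdmissible_extend
  have hsub : x - ((1 - l) • p.xbar + l • r) = (x - p.xbar) + l • (p.xbar - r) := by module
  have hsub' : (1 - l) • p.xbar + l • r - r = (1 - l) • (p.xbar - r) := by module
  have hnorm : ‖x - ((1 - l) • p.xbar + l • r)‖ ≤ ‖x - p.xbar‖ + l * ‖p.xbar - r‖ := by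
    rw [hsub]
    refine (norm_add_le _ _).trans_eq ?_
    rw [norm_smul, Real.norm_of_nonneg hl0.le]
  have hsmall : l * ‖p.xbar - r‖ ≤ δ / 2 :=
    (mul_le_mul_of_nonneg_left (by linarith [le_abs_self b]) hl0.le).trans hlb
  have hfeas := (hadm x ((1 - l) • p.xbar + l • r) ((1 - l) • p.ubar + l • ur)
    (hf.steady.convexComb hr l)
    (mulVec_convexComb_le hf.xbar_mem hrx hl0.le hl1)
    (mulVec_convexComb_le hf.ubar_mem hru hl0.le hl1) (by linarith)).isFeasible
  rw [auxPlan_state_zero] at hfeas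
  have hopt := hp.2 _ hfeas
  rw [cost_auxPlan hP, hsub', qform_smul] at hopt
  have hlow := le_cost (N := N) hQ hR hK hP r p
  have hPn := hPu (x - ((1 - l) • p.xbar + l • r))
  have hT1 := hTl (p.xbar - r)
  have hT2 := hTu (p.xbar - r)
  generalize qform D.T (p.xbar - r) = T at *
  generalize D.cost [N] r p = J at *
  have ha := norm_nonneg (x - p.xbar)
  have hd := norm_nonneg (p.xbar - r)
  have hw := norm_nonneg (x - ((1 - l) • p.xbar + l • r))
  generalize ‖x - p.xbar‖ = a at *
  generalize ‖p.xbar - r‖ = d at *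
  have hw2 : ‖x - ((1 - l) • p.xbar + l • r)‖ ^ 2 ≤ 2 * a ^ 2 + 2 * l ^ 2 * d ^ 2 := by
    calc _ ≤ (a + l * d) ^ 2 := by gcongr
      _ ≤ _ := by nlinarith [sq_nonneg (a - l * d)]
  have hq : qform D.P (x - ((1 - l) • p.xbar + l • r)) ≤ CP * (2 * a ^ 2 + 2 * l ^ 2 * d ^ 2) :=
    hPn.trans (mul_le_mul_of_nonneg_left hw2 hCP.le)
  generalize qform D.P (x - ((1 - l) • p.xbar + l • r)) = q at *
  have hT0 : 0 ≤ T := le_trans (by positivity) hT1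
  -- Optimality gives `T ≤ J ≤ q + (1 - l) ^ 2 * T`, and `1 - (1 - l) ^ 2 ≥ l` since `0 ≤ l ≤ 1`.
  have h1 : l * T ≤ q := by nlinarith [mul_nonneg (mul_nonneg hl0.le (sub_nonneg.2 hl1)) hT0]
  have h2 : 4 * CP * l * (l * d ^ 2) ≤ cT * (l * d ^ 2) :=
    mul_le_mul_of_nonneg_right hlP (by positivity)
  have h3 : l * (cT * d ^ 2) ≤ l * T := mul_le_mul_of_nonneg_left hT1 hl0.le
  have h4 : l * cT * d ^ 2 ≤ 4 * CP * a ^ 2 := by linarith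
  have h5 : d ^ 2 ≤ 4 * CP / (l * cT) * a ^ 2 := by
    rw [div_mul_eq_mul_div, le_div_iff₀ (by positivity)]
    linarith
  have h6 : (1 - l) ^ 2 * T ≤ T := mul_le_of_le_one_left hT0 (by nlinarith)
  have h7 : CP * (2 * l ^ 2 * d ^ 2) ≤ CP * (2 * d ^ 2) := by
    refine mul_le_mul_of_nonneg_left ?_ hCP.le
    have : l ^ 2 * d ^ 2 ≤ 1 * d ^ 2 :=
      mul_le_mul_of_nonneg_right (pow_le_one₀ hl0.le hl1) (by positivity)
    linarith
  calc J ≤ 2 * CP * a ^ 2 + (2 * CP + CT) * d ^ 2 := by linarith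
    _ ≤ 2 * CP * a ^ 2 + (2 * CP + CT) * (4 * CP / (l * cT) * a ^ 2) := by gcongr
    _ = _ := by ring

/-- A sequence of plans, each of which is at least as good as the remainder of its predecessor, and
which are optimal infinitely often, drives the state to the reference. -/
theorem tendsto_state_of_frequently_isSolution (hex : ∀ i, 0 < D.ex i) (heu : ∀ i, 0 < D.eu i)
    (hQ : D.Q.PosDef) (hR : D.R.PosDef) (hT : D.T.PosDef)
    (hK : IsSchur (D.A + D.B * D.K))
    (hP : D.P = (D.A + D.B * D.K)ᵀ * D.P * (D.A + D.B * D.K) + D.Q + D.Kᵀ * D.R * D.K)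
    {r : Fin nx → ℝ} {ur : Fin m → ℝ} (hr : D.IsSteady r ur) (hrx : r ∈ D.tight.stateSet)
    (hru : ur ∈ D.tight.inputSet) {p : ℕ → Plan nx m} (hadm : ∀ t, D.IsAdmissible N (p t))
    (hdec : ∀ t, D.cost [N] r (p (t + 1)) ≤ D.cost [N] r (p t).shift)
    (hopt : ∃ᶠ t in atTop, D.IsSolution [N] ((p t).state 0) r (p t)) :
    Tendsto (fun t => (p t).state 0) atTop (𝓝 r) := by
  obtain ⟨cQ, hcQ, hQl⟩ := exists_le_qform hQ
  obtain ⟨cT, hcT, hTl⟩ := exists_le_qform hT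
  set J : ℕ → ℝ := fun t => D.cost [N] r (p t) with hJ
  set e : ℕ → Fin nx → ℝ := fun t => (p t).state 0 - (p t).xbar with he
  have hTJ : ∀ t, cT * ‖(p t).xbar - r‖ ^ 2 ≤ J t := fun t =>
    (hTl _).trans (le_cost hQ hR hK hP r (p t))
  have hJ0 : ∀ t, 0 ≤ J t := fun t => le_trans (by positivity) (hTJ t)
  have hstep : ∀ t, cQ * ‖e t‖ ^ 2 ≤ J t - J (t + 1) := fun t => by
    have h1 := (hadm t).cost_shift hP r
    have h2 := qform_nonneg hR ((p t).input 0 - (p t).ubar)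
    have h3 := hQl (e t)
    have h4 := hdec t
    simp only [hJ, he] at *
    linarith
  have hanti : Antitone J := antitone_nat_of_succ_le fun t => by
    have : 0 ≤ cQ * ‖e t‖ ^ 2 := by positivity
    linarith [hstep t]
  have hlim := tendsto_atTop_ciInf hanti ⟨0, by rintro _ ⟨t, rfl⟩; exact hJ0 t⟩
  have hsq : ∀ {a : ℕ → Fin nx → ℝ} {c : ℝ} {f : ℕ → ℝ}, 0 < c →
      (∀ t, c * ‖a t‖ ^ 2 ≤ f t) → Tendsto f atTop (𝓝 0) →
      Tendsto (fun t => ‖a t‖ ^ 2) atTop (𝓝 0) := fun {a c f} hc h hf => by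
    refine squeeze_zero (fun t => by positivity) (fun t => ?_) (by simpa using hf.div_const c)
    rw [le_div_iff₀' hc]
    exact h t
  have hzero : ∀ {a : ℕ → Fin nx → ℝ}, Tendsto (fun t => ‖a t‖ ^ 2) atTop (𝓝 0) →
      Tendsto a atTop (𝓝 0) := fun {a} h => by
    refine tendsto_zero_iff_norm_tendsto_zero.2 ?_
    simpa using h.sqrt
  -- The squared errors are dominated by the decrements of a convergent sequence.
  have he2 : Tendsto (fun t => ‖e t‖ ^ 2) atTop (𝓝 0) :=
    hsq hcQ hstep (by simpa using hlim.sub ((tendsto_add_atTop_iff_nat 1).2 hlim))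
  -- The constants of `exists_cost_le_of_isSolution` depend on a bound for the offset; monotonicity
  -- of `J` provides one for all times.
  have hbound : ∀ t, ‖(p t).xbar - r‖ ≤ √(J 0 / cT) := fun t => by
    refine Real.le_sqrt_of_sq_le ?_
    rw [le_div_iff₀' hcT]
    exact (hTJ t).trans (hanti (Nat.zero_le t))
  obtain ⟨δ, hδ, C, hC, hle⟩ := exists_cost_le_of_isSolution (N := N) hex heu hQ hR hT hK hP
    hr hrx hru (√(J 0 / cT))
  have hclose : ∀ᶠ t in atTop, ‖e t‖ ≤ δ :=
    (tendsto_zero_iff_norm_tendsto_zero.1 (hzero he2)).eventually_le_const hδ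
  have hfreq : ∃ᶠ t in atTop, J t ≤ C * ‖e t‖ ^ 2 :=
    (hopt.and_eventually hclose).mono fun t ht => hle _ _ ht.1 ht.2 (hbound t)
  have hinf : ⨅ t, J t = 0 := by
    refine le_antisymm ?_ (le_ciInf hJ0)
    -- Since `J` converges, a bound at infinitely many times suffices to identify its limit.
    have := le_of_tendsto_of_tendsto_of_frequently hlim (he2.const_mul C) hfreq
    simpa using this
  rw [hinf] at hlim
  have hd : Tendsto (fun t => (p t).xbar - r) atTop (𝓝 0) := hzero (hsq hcT hTJ hlim)
  have := ((hzero he2).add hd).add_const r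
  simpa [he] using this

end Data

end Convergence

/-! ### Correctness of the estimator under the consistency test -/

namespace IsClosedLoop

section Estimator

variable {nx m cx cu : ℕ} {D : Data nx m cx cu} {H : List ℕ} {n : ℕ} {r : Fin nx → ℝ}
  {γ θ : ℕ → Bool} {ρ : Run nx m} {τ t : ℕ}

/-- The initial stamp is arbitrary, so a stamp marks a genuine reception only after some reception
`τ`. -/
theorem stamp_spec (h : IsClosedLoop D H n r γ θ ρ) (hτ : γ τ = true) (ht : τ < t) :
    γ (ρ.q t) = true ∧ τ ≤ ρ.q t ∧ ρ.q t < t := by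
  induction t, ht using Nat.le_induction with
  | base => simp [h.stamp, hτ]
  | succ t ht ih =>
    rw [h.stamp]
    split_ifs with hγ
    · exact ⟨hγ, by omega, by omega⟩
    · exact ⟨ih.1, ih.2.1, by omega⟩

/-- If every packet sent since the stamp has arrived, each one passes the test, and the actuator
uses the most recently sent packet, as the estimator supposes. -/
theorem index_eq (hn : 0 < n) (h : IsClosedLoop D H n r γ θ ρ) (hτ : γ τ = true) (ht : τ < t)
    (hθ : ∀ k, ρ.q t + 1 + k * n ≤ t → θ (ρ.q t + 1 + k * n) = true) :
    ρ.s t = t - t % n := by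
  induction t with
  | zero => omega
  | succ t ih =>
    obtain ⟨hγ, -, hlt⟩ := h.stamp_spec hτ ht
    by_cases hdvd : n ∣ t + 1
    · have hcons : Consistent n θ (ρ.q (t + 1)) (t + 1) := by
        refine ⟨?_, fun k hk => hθ k ?_⟩
        -- Both `q + 1` and `t + 1` are multiples of `n`, so the packet of time `t + 1` is among
        -- those assumed to arrive.
        · obtain ⟨k, hk⟩ := (Nat.dvd_sub hdvd (h.plant_sends _ hγ))
          have e : ρ.q (t + 1) + 1 + k * n = t + 1 := by
            rw [mul_comm k, ← hk]
            omega
          have := hθ k e.le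
          rwa [e] at this
        · have := (Nat.le_div_iff_mul_le hn).1 hk
          omega
      rw [h.accept t hcons, Nat.mod_eq_zero_of_dvd hdvd, Nat.sub_zero]
    -- Between sending instants no plant packet arrives and no controller packet is available, so
    -- stamp and index persist.
    · have hγt : γ t ≠ true := fun hc => hdvd (h.plant_sends t hc)
      have hq : ρ.q (t + 1) = ρ.q t := by rw [h.stamp, if_neg hγt]
      have hτt : τ < t := by
        rcases (Nat.lt_succ_iff.1 ht).eq_or_lt with rfl | hlt
        · exact absurd hτ hγt
        · exact hlt
      rw [h.keep t fun hc => hdvd (h.ctrl_sends _ hc.1),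
        ih hτt fun k hk => by rw [hq] at hθ; exact hθ k (by omega)]
      have h1 := Nat.div_add_mod t n
      have h2 := Nat.div_add_mod (t + 1) n
      rw [Nat.succ_div_of_not_dvd hdvd] at h2
      omega

/-- A reception resets the estimate; without one, `index_eq` shows that the assumed input is the
applied one. The inequality is strict because predicting `x t` involves inputs up to time `t - 1`
only. -/
theorem xhat_eq (hn : 0 < n) (h : IsClosedLoop D H n r γ θ ρ) (hτ : γ τ = true) (ht : τ < t)
    (hθ : ∀ k, ρ.q t + 1 + k * n < t → θ (ρ.q t + 1 + k * n) = true) :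
    ρ.xhat t = ρ.x t := by
  induction t with
  | zero => omega
  | succ t ih =>
    rw [h.estimator, h.plant]
    by_cases hγt : γ t = true
    · simp [Run.xcur, Run.ucur, hγt]
    · have hq : ρ.q (t + 1) = ρ.q t := by rw [h.stamp, if_neg hγt]
      have hτt : τ < t := by
        rcases (Nat.lt_succ_iff.1 ht).eq_or_lt with rfl | hlt
        · exact absurd hτ hγt
        · exact hlt
      rw [hq] at hθ
      have hx := ih hτt fun k hk => hθ k (by omega)
      have hs := h.index_eq hn hτ hτt fun k hk => hθ k (by omega)
      have hu := h.actuator t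
      rw [hs, Nat.sub_sub_self (Nat.mod_le t n)] at hu
      simp [Run.xcur, Run.ucur, hγt, hx, hu]

theorem xhat_eq_of_consistent (hn : 0 < n) (h : IsClosedLoop D H n r γ θ ρ) (hτ : γ τ = true)
    (ht : τ < t) (hc : Consistent n θ (ρ.q t) t) : ρ.xhat t = ρ.x t :=
  h.xhat_eq hn hτ ht fun k hk => hc.2 k ((Nat.le_div_iff_mul_le hn).2 (by omega))

/-- Right after a reception the stamp is `τ`, and the test asks for the packet of time `τ + 1`
alone. -/
theorem consistent_succ (h : IsClosedLoop D H n r γ θ ρ) (hτ : γ τ = true)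
    (hθ : θ (τ + 1) = true) : Consistent n θ (ρ.q (τ + 1)) (τ + 1) := by
  rw [h.stamp, if_pos hτ]
  refine ⟨hθ, fun k hk => ?_⟩
  rw [show τ + 1 - τ - 1 = 0 by omega, Nat.zero_div, Nat.le_zero] at hk
  simpa [hk] using hθ

theorem isSolution_of_consistent (hn : 0 < n) (h : IsClosedLoop D H n r γ θ ρ)
    (hτ : γ τ = true) (ht : τ < t + 1) (hc : Consistent n θ (ρ.q (t + 1)) (t + 1))
    (hf : D.ProblemFeasible H (ρ.x (t + 1))) :
    D.IsSolution H (ρ.x (t + 1)) r (ρ.plan (t + 1)) := by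
  have hx := h.xhat_eq_of_consistent hn hτ ht hc
  have := h.solve t (h.ctrl_sends _ hc.1)
  rw [hx] at this
  exact this hf

end Estimator

end IsClosedLoop

/-! ### The buffered plan as a Lyapunov certificate for the closed loop -/

section CurrentPlan

variable {nx m cx cu : ℕ} {D : Data nx m cx cu} {N n : ℕ} {r : Fin nx → ℝ}
  {γ θ : ℕ → Bool} {ρ : Run nx m} {τ t : ℕ}

/-- What remains at time `t` of the plan in the buffer. -/
def Run.current (ρ : Run nx m) (D : Data nx m cx cu) (N t : ℕ) : Plan nx m :=
  Plan.shift^[t - ρ.s t] ((ρ.plan (ρ.s t)).extend D N)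

/-- The plan in the buffer at time `t` is feasible and describes the current state correctly. -/
structure Run.IsOnPlan (ρ : Run nx m) (D : Data nx m cx cu) (N t : ℕ) : Prop where
  index_le : ρ.s t ≤ t
  feasible : D.IsFeasible [N] ((ρ.plan (ρ.s t)).state 0) (ρ.plan (ρ.s t))
  state_zero : (ρ.current D N t).state 0 = ρ.x t

theorem Run.IsOnPlan.isAdmissible (h : ρ.IsOnPlan D N t) :
    D.IsAdmissible N (ρ.current D N t) :=
  h.feasible.isAdmissible_extend.iterate_shift _

namespace IsClosedLoop

theorem isOnPlan_of_isSolution (hs : ρ.s t = t)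
    (hsol : D.IsSolution [N] (ρ.x t) r (ρ.plan t)) :
    ρ.IsOnPlan D N t ∧ D.IsSolution [N] (ρ.x t) r (ρ.current D N t) := by
  have hcur : ρ.current D N t = (ρ.plan t).extend D N := by
    simp [Run.current, hs]
  have h0 := hsol.1.extend_state_zero
  refine ⟨⟨hs.le, ?_, by rw [hcur, h0]⟩, ?_⟩
  · rw [hs, hsol.1.init]
    exact hsol.1
  · have := hsol.1.isAdmissible_extend.isFeasible
    rw [h0] at this
    rw [hcur]
    refine ⟨this, fun p' hp' => ?_⟩
    rw [Data.cost_extend]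
    exact hsol.2 p' hp'

theorem x_succ_eq (h : IsClosedLoop D [N] n r γ θ ρ) (ht : ρ.IsOnPlan D N t) :
    ρ.x (t + 1) = (ρ.current D N t).shift.state 0 := by
  have hu : ρ.u t = (ρ.current D N t).input 0 := by
    have hx := ht.state_zero
    rw [Run.current, Plan.iterate_shift_state, Nat.zero_add] at hx
    rw [h.actuator, ← hx, ht.feasible.packetInput_extend, Run.current, Plan.iterate_shift_input,
      Nat.zero_add]
  rw [h.plant, hu, ← ht.state_zero]
  exact (ht.isAdmissible.dyn 0).symm

/-- The remainder of the plan is feasible at the new state. An accepted packet is therefore optimal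
and at least as good; otherwise the remainder itself is kept. -/
theorem isOnPlan_succ (hn : 0 < n) (h : IsClosedLoop D [N] n r γ θ ρ) (hτ : γ τ = true)
    (hlt : τ < t) (ht : ρ.IsOnPlan D N t) :
    ρ.IsOnPlan D N (t + 1) ∧
      D.cost [N] r (ρ.current D N (t + 1)) ≤ D.cost [N] r (ρ.current D N t).shift ∧
      (Consistent n θ (ρ.q (t + 1)) (t + 1) →
        D.IsSolution [N] (ρ.x (t + 1)) r (ρ.current D N (t + 1))) := by
  have hx := h.x_succ_eq ht
  have hfeas := ht.isAdmissible.shift.isFeasible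
  rw [← hx] at hfeas
  by_cases hc : Consistent n θ (ρ.q (t + 1)) (t + 1)
  · have hsol := h.isSolution_of_consistent hn hτ (by omega) hc ⟨_, hfeas⟩
    obtain ⟨h1, h2⟩ := isOnPlan_of_isSolution (h.accept t hc) hsol
    exact ⟨h1, h2.2 _ hfeas, fun _ => h2⟩
  · have hs := h.keep t hc
    have hcur : ρ.current D N (t + 1) = (ρ.current D N t).shift := by
      rw [Run.current, hs, Nat.succ_sub ht.index_le, Function.iterate_succ_apply', Run.current]
    exact ⟨⟨hs.trans_le (ht.index_le.trans t.le_succ), hs ▸ ht.feasible, by rw [hcur, hx]⟩,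
      by rw [hcur], fun hc' => absurd hc' hc⟩

theorem tendsto_state (hn : 0 < n) (hex : ∀ i, 0 < D.ex i) (heu : ∀ i, 0 < D.eu i)
    (hQ : D.Q.PosDef) (hR : D.R.PosDef) (hT : D.T.PosDef)
    (hK : IsSchur (D.A + D.B * D.K))
    (hP : D.P = (D.A + D.B * D.K)ᵀ * D.P * (D.A + D.B * D.K) + D.Q + D.Kᵀ * D.R * D.K)
    (hr : ∃ ur : Fin m → ℝ, D.IsSteady r ur ∧ r ∈ D.tight.stateSet ∧ ur ∈ D.tight.inputSet)
    (h : IsClosedLoop D [N] n r γ θ ρ)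
    (hnet : ∀ t, ∃ τ, t ≤ τ ∧ γ τ = true ∧ θ (τ + 1) = true)
    (hfeas : ∃ t, γ t = true ∧ θ (t + 1) = true ∧ D.ProblemFeasible [N] (ρ.x (t + 1))) :
    Tendsto ρ.x atTop (𝓝 r) := by
  obtain ⟨ur, hrs, hrx, hru⟩ := hr
  obtain ⟨τ, hγ, hθ, hf⟩ := hfeas
  have hc := h.consistent_succ hγ hθ
  -- Time is counted from `τ + 1`, the first instant at which the buffer is known to hold a feasible
  -- plan.
  have hon : ∀ k, ρ.IsOnPlan D N (τ + 1 + k) := fun k => by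
    induction k with
    | zero =>
      exact (isOnPlan_of_isSolution (h.accept τ hc)
        (h.isSolution_of_consistent hn hγ τ.lt_succ_self hc hf)).1
    | succ k ih => exact (h.isOnPlan_succ hn hγ (by omega) ih).1
  have hlim := Data.tendsto_state_of_frequently_isSolution hex heu hQ hR hT hK hP hrs hrx hru
    (p := fun k => ρ.current D N (τ + 1 + k)) (fun k => (hon k).isAdmissible)
    (fun k => (h.isOnPlan_succ hn hγ (by omega) (hon k)).2.1) ?_
  · refine (tendsto_add_atTop_iff_nat (τ + 1)).1 (hlim.congr fun k => ?_)
    rw [(hon k).state_zero, add_comm]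
  · refine frequently_atTop.2 fun k => ?_
    obtain ⟨σ, hσ, hγσ, hθσ⟩ := hnet (τ + 1 + k)
    -- A reception at `σ = τ + 1 + j` yields an optimal plan one step later, hence the index `j +
    -- 1`.
    obtain ⟨j, rfl⟩ := Nat.exists_eq_add_of_le (show τ + 1 ≤ σ by omega)
    refine ⟨j + 1, by omega, ?_⟩
    rw [(hon (j + 1)).state_zero]
    exact (h.isOnPlan_succ hn hγ (by omega) (hon j)).2.2 (h.consistent_succ hγσ hθσ)

end IsClosedLoop

end CurrentPlan

end NetMPC

end

theorem mainTheorem4 {nx m cx cu : ℕ} (D : NetMPC.Data nx m cx cu) (N n : ℕ) (hn : 0 < n)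
    (hex : ∀ i, 0 < D.ex i) (heu : ∀ i, 0 < D.eu i)
    (hQ : D.Q.PosDef) (hR : D.R.PosDef) (hT : D.T.PosDef)
    (hK : NetMPC.IsSchur (D.A + D.B * D.K))
    (hP : D.P = (D.A + D.B * D.K)ᵀ * D.P * (D.A + D.B * D.K) + D.Q + D.Kᵀ * D.R * D.K)
    (r : Fin nx → ℝ)
    (hr : ∃ ur : Fin m → ℝ, D.IsSteady r ur ∧ r ∈ D.tight.stateSet ∧ ur ∈ D.tight.inputSet)
    {Ω : Type*} [MeasurableSpace Ω] (μ : Measure Ω) [IsProbabilityMeasure μ]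
    (γ θ : ℕ → Ω → Bool) (hγ : ∀ t, Measurable (γ t)) (hθ : ∀ t, Measurable (θ t))
    (hnet : ∀ᵐ ω ∂μ, ∀ t, ∃ τ, t ≤ τ ∧ γ τ ω = true ∧ θ (τ + 1) ω = true)
    (ρ : Ω → NetMPC.Run nx m)
    (hloop : ∀ᵐ ω ∂μ, NetMPC.IsClosedLoop D [N] n r (fun t => γ t ω) (fun t => θ t ω) (ρ ω))
    (hfeas : ∀ᵐ ω ∂μ, ∃ t, γ t ω = true ∧ θ (t + 1) ω = true ∧
      D.ProblemFeasible [N] ((ρ ω).x (t + 1))) :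
    ∀ᵐ ω ∂μ, Tendsto (fun t => (ρ ω).x t) atTop (𝓝 r) := by
  filter_upwards [hnet, hloop, hfeas] with ω h1 h2 h3
  exact h2.tendsto_state hn hex heu hQ hR hT hK hP hr h1 h3
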